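/- Every pretopos is diexact. Here a \emph{pretopos} is a finitely complete category which is Barr-exact (regular, with every internal equivalence relation a kernel pair) and finitary extensive. In a finitely complete category $\mathcal C$, a \emph{Mal'cev span} is a jointly monic span $f\colon A \leftarrow S \rightarrow B \colon g$ for which there is a morphism $m\colon S\times_B S\times_A S\to S$ (the domain being the object of triples $(x_1,x_2,x_3)$ with $g x_1=g x_2$ and $f x_2=f x_3$) such that $f m = f\pi_1$ and $g m = g\pi_3$. A finitely complete category is \emph{diexact} if every Mal'cev span in it admits a pushout, and every pushout square of a Mal'cev span is stable under pullback and is itself a pullback square. -/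

import Mathlib

open CategoryTheory CategoryTheory.Limits

universe v u

/-- A Barr-exact category: a regular category (in particular, one with finite limits) in which
every internal equivalence relation is effective, i.e. is the kernel pair of some morphism. -/
class BarrExact (C : Type u) [Category.{v} C] : Prop extends Regular C where
  exists_isKernelPair : ∀ {R X : C} (s t : R ⟶ X), IsEquivalenceRelation s t →
    ∃ (Y : C) (q : X ⟶ Y), IsKernelPair q s t

/-- A pretopos: a finitely complete category which is Barr-exact and (finitary) extensive.
Finite completeness is part of regularity. -/
class Pretopos (C : Type u) [Category.{v} C] : Prop extends BarrExact C, FinitaryExtensive C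

/-- A span `A ⟵ S ⟶ B` with legs `f` and `g` is a Mal'cev span if it is jointly monic and the
span `S ×_B S ×_A S ⟶ A, B` with legs `π₁ ≫ f` and `π₃ ≫ g` factors through it.
Here `S ×_B S ×_A S` is formed as `(S ×_B S) ×_A S`, with generalised elements the triples
`((x₁, x₂), x₃)` such that `g x₁ = g x₂` and `f x₂ = f x₃`. -/
structure IsMalcevSpan {C : Type u} [Category.{v} C] [HasFiniteLimits C] {S A B : C}
    (f : S ⟶ A) (g : S ⟶ B) : Prop where
  jointlyMono : JointlyMono₂ f g
  exists_factorization : ∃ m : pullback (pullback.snd g g ≫ f) f ⟶ S,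
    m ≫ f = (pullback.fst (pullback.snd g g ≫ f) f ≫ pullback.fst g g) ≫ f ∧
    m ≫ g = pullback.snd (pullback.snd g g ≫ f) f ≫ g

/-- The commutative square
```
  S --g--> B
  |        |
  f        k
  v        v
  A --h--> D
```
is a pushout which is stable under pullback: for each `d : D' ⟶ D`, the square obtained by
pulling the whole square back along `d` is again a pushout. The pulled-back square is presented
as the top face of a commutative cube over the given square, with all four side faces
pullbacks. -/
structure IsStablePushout {C : Type u} [Category.{v} C] {S A B D : C}
    (f : S ⟶ A) (g : S ⟶ B) (h : A ⟶ D) (k : B ⟶ D) : Prop where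
  isPushout : IsPushout f g h k
  isPushout_of_cube : ∀ {S' A' B' D' : C}
    (f' : S' ⟶ A') (g' : S' ⟶ B') (h' : A' ⟶ D') (k' : B' ⟶ D')
    (c : S' ⟶ S) (a : A' ⟶ A) (b : B' ⟶ B) (d : D' ⟶ D),
    f' ≫ h' = g' ≫ k' →
    IsPullback f' c a f → IsPullback g' c b g →
    IsPullback h' a d h → IsPullback k' b d k →
    IsPushout f' g' h' k'

/-- A diexact category: a finitely complete category which admits pushouts of Mal'cev spans,
every such pushout square being stable under pullback and itself a pullback square. -/
class Diexact (C : Type u) [Category.{v} C] : Prop extends HasFiniteLimits C where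
  hasPushout : ∀ {S A B : C} (f : S ⟶ A) (g : S ⟶ B), IsMalcevSpan f g → HasPushout f g
  isStablePushout : ∀ {S A B D : C} (f : S ⟶ A) (g : S ⟶ B) (h : A ⟶ D) (k : B ⟶ D),
    IsMalcevSpan f g → IsPushout f g h k → IsStablePushout f g h k
  isPullback : ∀ {S A B D : C} (f : S ⟶ A) (g : S ⟶ B) (h : A ⟶ D) (k : B ⟶ D),
    IsMalcevSpan f g → IsPushout f g h k → IsPullback f g h k

/-! Call generalised elements s, s' of S linked when (f s, g s') lies in S. The Mal'cev condition
makes this an equivalence relation on elements of S, and hence (via `Over.linked`) so is `Glued` on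
A ⨿ B, which identifies images of linked elements. Exactness yields a quotient D of A ⨿ B with this
kernel pair (`exists_isGluing`). By disjointness of coproducts, a in A and b in B agree in D exactly
when (a, b) lies in S: the square is a pullback. Covers and coproduct decompositions are stable, so
the description of the kernel pair transports along any D' ⟶ D and makes the pulled-back square a
pushout; the identity cube gives the pushout itself. `IsJointlyExtremal` stands in for the internal
logic: membership in a subobject may be tested locally. -/

namespace CategoryTheory

attribute [local simp] coprod.inl_desc coprod.inl_desc_assoc coprod.inr_desc coprod.inr_desc_assoc
  prod.lift_fst prod.lift_fst_assoc prod.lift_snd prod.lift_snd_assoc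
  pullback.lift_fst pullback.lift_fst_assoc pullback.lift_snd pullback.lift_snd_assoc

variable {C : Type u} [Category.{v} C]

/-! ### Local reasoning: jointly extremal families -/

section JointlyExtremal

/-- A family of morphisms with codomain `W` is jointly extremal if a morphism out of `W` factors
through a monomorphism as soon as all its restrictions along the family do. -/
def IsJointlyExtremal {W : C} (P : ∀ ⦃W' : C⦄, (W' ⟶ W) → Prop) : Prop :=
  ∀ ⦃E Y : C⦄ (e : E ⟶ Y) [Mono e] (y : W ⟶ Y),
    (∀ ⦃W' : C⦄ (i : W' ⟶ W), P i → ∃ l, l ≫ e = i ≫ y) → ∃ l, l ≫ e = y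

lemma IsJointlyExtremal.hom_ext [HasEqualizers C] {W : C}
    {P : ∀ ⦃W' : C⦄, (W' ⟶ W) → Prop} (hP : IsJointlyExtremal P) {T : C} {x y : W ⟶ T}
    (h : ∀ ⦃W' : C⦄ (i : W' ⟶ W), P i → i ≫ x = i ≫ y) : x = y := by
  obtain ⟨l, hl⟩ := hP (equalizer.ι x y) (𝟙 W) fun W' i hi =>
    ⟨equalizer.lift i (h i hi), by simp⟩
  rw [← Category.id_comp x, ← Category.id_comp y, ← hl, Category.assoc, Category.assoc,
    equalizer.condition]

lemma IsJointlyExtremal.bind {W : C} {P R : ∀ ⦃W' : C⦄, (W' ⟶ W) → Prop}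
    {Q : ∀ ⦃W' : C⦄ (_ : W' ⟶ W) ⦃W'' : C⦄, (W'' ⟶ W') → Prop} (hP : IsJointlyExtremal P)
    (hQ : ∀ ⦃W' : C⦄ (i : W' ⟶ W), P i → IsJointlyExtremal (Q i))
    (hR : ∀ ⦃W' : C⦄ (i : W' ⟶ W), P i → ∀ ⦃W'' : C⦄ (j : W'' ⟶ W'), Q i j → R (j ≫ i)) :
    IsJointlyExtremal R := fun _ _ e _ y h =>
  hP e y fun _ i hi => hQ i hi e (i ≫ y) fun _ j hj => by
    simpa using h (j ≫ i) (hR i hi j hj)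

lemma isJointlyExtremal_of_isRegularEpi [Regular C] {P E W : C} (c : P ⟶ E) [IsRegularEpi c]
    (w : W ⟶ E) :
    IsJointlyExtremal fun ⦃W' : C⦄ (i : W' ⟶ W) => ∃ a : W' ⟶ P, i ≫ w = a ≫ c := by
  intro E' Y e _ y h
  obtain ⟨l, hl⟩ := h (pullback.snd c w) ⟨pullback.fst c w, pullback.condition.symm⟩
  have : StrongEpi (pullback.snd c w) := inferInstance
  have sq : CommSq l (pullback.snd c w) e y := ⟨hl⟩
  exact ⟨sq.lift, sq.fac_right⟩

/-- By extensivity, pulling the two inclusions back along z exhibits W as a coproduct. -/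
lemma isJointlyExtremal_of_coprod [FinitaryExtensive C] [HasPullbacks C] {P Q W : C}
    (z : W ⟶ P ⨿ Q) :
    IsJointlyExtremal fun ⦃W' : C⦄ (i : W' ⟶ W) =>
      (∃ a : W' ⟶ P, i ≫ z = a ≫ coprod.inl) ∨ ∃ b : W' ⟶ Q, i ≫ z = b ≫ coprod.inr := by
  intro E Y e _ y h
  obtain ⟨l₁, h₁⟩ := h (pullback.fst z coprod.inl) (.inl ⟨_, pullback.condition⟩)
  obtain ⟨l₂, h₂⟩ := h (pullback.fst z coprod.inr) (.inr ⟨_, pullback.condition⟩)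
  have H := (BinaryCofan.isVanKampen_iff _).1
    (FinitaryExtensive.vanKampen _ (coprodIsCoprod P Q))
    (BinaryCofan.mk (pullback.fst z coprod.inl) (pullback.fst z coprod.inr))
    (pullback.snd _ _) (pullback.snd _ _) z pullback.condition.symm pullback.condition.symm
  obtain ⟨hc⟩ := H.2 ⟨.of_hasPullback _ _, .of_hasPullback _ _⟩
  obtain ⟨l, hl₁, hl₂⟩ := BinaryCofan.IsColimit.desc' hc l₁ l₂
  refine ⟨l, BinaryCofan.IsColimit.hom_ext hc ?_ ?_⟩
  · exact (Category.assoc _ _ _).symm.trans ((congrArg (· ≫ e) hl₁).trans h₁)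
  · exact (Category.assoc _ _ _).symm.trans ((congrArg (· ≫ e) hl₂).trans h₂)

/-- Coproduct inclusions are disjoint: their "intersection" is (strict) initial. -/
lemma nonempty_isInitial_of_inl_eq_inr [FinitaryExtensive C] {W P Q : C} {a : W ⟶ P} {b : W ⟶ Q}
    (h : a ≫ coprod.inl = b ≫ (coprod.inr : Q ⟶ P ⨿ Q)) : Nonempty (IsInitial W) := by
  have hp := FinitaryExtensive.isPullback_initial_to_binaryCofan (coprodIsCoprod P Q)
  have : IsIso (hp.lift a b h) := initialIsInitial.isIso_to _
  exact ⟨initialIsInitial.ofIso (asIso (hp.lift a b h)).symm⟩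

end JointlyExtremal

lemma IsEquivalenceRelation.of_generalizedElements [HasPullbacks C] {R X : C} {s t : R ⟶ X}
    (jm : JointlyMono₂ s t) (refl : ∃ r : X ⟶ R, r ≫ s = 𝟙 X ∧ r ≫ t = 𝟙 X)
    (symm : ∃ σ : R ⟶ R, σ ≫ s = t ∧ σ ≫ t = s)
    (trans : ∀ ⦃W : C⦄ (a b : W ⟶ R), a ≫ t = b ≫ s → ∃ c, c ≫ s = a ≫ s ∧ c ≫ t = b ≫ t) :
    IsEquivalenceRelation s t := by
  obtain ⟨r, hr₁, hr₂⟩ := refl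
  obtain ⟨σ, hσ₁, hσ₂⟩ := symm
  obtain ⟨c, hc₁, hc₂⟩ := trans (pullback.fst t s) (pullback.snd t s) pullback.condition
  exact ⟨⟨{ jm with
    r := r
    reflexivity₁ := hr₁
    reflexivity₂ := hr₂
    s := σ
    symmetry₁ := hσ₁
    symmetry₂ := hσ₂
    c := pullback.cone t s
    isLimit := pullback.isLimit t s
    t := c
    transitivity₁ := hc₁
    transitivity₂ := hc₂ }⟩⟩

/-- In a Barr-exact category, every equivalence relation is the kernel pair of a regular
epimorphism. -/
lemma BarrExact.exists_isRegularEpi_isKernelPair [BarrExact C] {R X : C} (s t : R ⟶ X)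
    (h : IsEquivalenceRelation s t) :
    ∃ (D : C) (q : X ⟶ D), IsRegularEpi q ∧ IsKernelPair q s t := by
  obtain ⟨Y, q, hq⟩ := BarrExact.exists_isKernelPair s t h
  let F := Regular.strongEpiMonoFactorisation q
  refine ⟨F.I, F.e, inferInstance, ?_⟩
  have hq' : IsKernelPair (F.e ≫ F.m) s t := by rwa [F.fac]
  exact hq'.cancel_right_of_mono

lemma isRegularEpi_of_factors [Regular C] {X Y : C} (p : X ⟶ Y)
    (h : ∀ ⦃Z : C⦄ (u : X ⟶ Z) (i : Z ⟶ Y) [Mono i], u ≫ i = p → ∃ l, l ≫ i = 𝟙 Y) :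
    IsRegularEpi p := by
  have : ExtremalEpi p := .mk_of_hasEqualizers _ fun Z u i hi _ => by
    obtain ⟨l, hl⟩ := h u i hi
    exact ⟨l, by rw [← cancel_mono i]; simp [hl], hl⟩
  infer_instance

end CategoryTheory

namespace IsMalcevSpan

open CategoryTheory

attribute [local simp] coprod.inl_desc coprod.inl_desc_assoc coprod.inr_desc coprod.inr_desc_assoc
  prod.lift_fst prod.lift_fst_assoc prod.lift_snd prod.lift_snd_assoc
  pullback.lift_fst pullback.lift_fst_assoc pullback.lift_snd pullback.lift_snd_assoc

variable {C : Type u} [Category.{v} C]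

/-! ### The gluing relation on the coproduct -/

section Relations

variable {S A B : C} (f : S ⟶ A) (g : S ⟶ B)

/-- Generalised elements `s` and `s'` of `S` are linked if `(f s, g s')` belongs to the
relation `S`. -/
def Linked {W : C} (s s' : W ⟶ S) : Prop :=
  ∃ t : W ⟶ S, t ≫ f = s ≫ f ∧ t ≫ g = s' ≫ g

variable {f g} in
lemma Linked.comp {W W' : C} {s s' : W ⟶ S} (h : Linked f g s s') (i : W' ⟶ W) :
    Linked f g (i ≫ s) (i ≫ s') := by
  obtain ⟨t, h₁, h₂⟩ := h
  exact ⟨i ≫ t, by simp [h₁], by simp [h₂]⟩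

variable [HasBinaryCoproducts C]

/-- The generalised element `x` of `A ⨿ B` is one of the two images of `s`. -/
def Over {W : C} (s : W ⟶ S) (x : W ⟶ A ⨿ B) : Prop :=
  x = s ≫ f ≫ coprod.inl ∨ x = s ≫ g ≫ coprod.inr

/-- The generalised elements `x` and `y` of `A ⨿ B` are identified in the pushout of `f` and `g`:
locally, they are equal, or are images of linked elements of `S`. -/
def Glued {W : C} (x y : W ⟶ A ⨿ B) : Prop :=
  IsJointlyExtremal fun ⦃W' : C⦄ (i : W' ⟶ W) =>
    i ≫ x = i ≫ y ∨ ∃ s s' : W' ⟶ S, Linked f g s s' ∧ Over f g s (i ≫ x) ∧ Over f g s' (i ≫ y)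

/-- `h` and `k` exhibit `D` as the quotient of `A ⨿ B` by the relation `Glued f g`. -/
structure IsGluing {D : C} (h : A ⟶ D) (k : B ⟶ D) : Prop where
  w : f ≫ h = g ≫ k
  isRegularEpi : IsRegularEpi (coprod.desc h k)
  glued : ∀ ⦃W : C⦄ (x y : W ⟶ A ⨿ B), x ≫ coprod.desc h k = y ≫ coprod.desc h k → Glued f g x y

variable {f g}

lemma Over.comp {W W' : C} {s : W ⟶ S} {x : W ⟶ A ⨿ B} (h : Over f g s x) (i : W' ⟶ W) :
    Over f g (i ≫ s) (i ≫ x) := by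
  rcases h with rfl | rfl
  · exact .inl (by simp)
  · exact .inr (by simp)

lemma Over.comp_desc {W D : C} {s : W ⟶ S} {x : W ⟶ A ⨿ B} {h : A ⟶ D} {k : B ⟶ D}
    (hx : Over f g s x) (w : f ≫ h = g ≫ k) : x ≫ coprod.desc h k = s ≫ f ≫ h := by
  rcases hx with rfl | rfl
  · simp
  · simp [w]

lemma IsGluing.comp_iso {D D' : C} {h : A ⟶ D} {k : B ⟶ D} (H : IsGluing f g h k) (φ : D ≅ D') :
    IsGluing f g (h ≫ φ.hom) (k ≫ φ.hom) := by
  have e : coprod.desc (h ≫ φ.hom) (k ≫ φ.hom) = coprod.desc h k ≫ φ.hom := by ext <;> simp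
  refine ⟨by simp [reassoc_of% H.w], ?_, fun W x y hxy => H.glued x y ?_⟩
  · rw [e]
    exact ⟨⟨(H.isRegularEpi.getStruct _).ofArrowIso
      (Arrow.isoMk (f := .mk (coprod.desc h k)) (Iso.refl _) φ)⟩⟩
  · rw [e, ← Category.assoc, ← Category.assoc] at hxy
    exact (cancel_mono φ.hom).1 hxy

/-- This is the matching step in transitivity of gluing. If s and s' have the same image under one
leg, s' or s itself is the witness; the mixed cases live over an initial object. -/
lemma Over.linked [FinitaryExtensive C] {W : C} {s s' : W ⟶ S} {x : W ⟶ A ⨿ B}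
    (h : Over f g s x) (h' : Over f g s' x) : Linked f g s s' := by
  rcases h with rfl | rfl <;> rcases h' with h' | h'
  · have : s ≫ f = s' ≫ f := by simpa [← Category.assoc, cancel_mono] using h'
    exact ⟨s', this.symm, rfl⟩
  · simp only [← Category.assoc] at h'
    obtain ⟨hW⟩ := nonempty_isInitial_of_inl_eq_inr h'
    exact ⟨hW.to _, hW.hom_ext _ _, hW.hom_ext _ _⟩
  · simp only [← Category.assoc] at h'
    obtain ⟨hW⟩ := nonempty_isInitial_of_inl_eq_inr h'.symm
    exact ⟨hW.to _, hW.hom_ext _ _, hW.hom_ext _ _⟩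
  · have : s ≫ g = s' ≫ g := by simpa [← Category.assoc, cancel_mono] using h'
    exact ⟨s, rfl, this⟩

end Relations

/-! ### Consequences of the Mal'cev condition -/

section Malcev

variable [HasFiniteLimits C] {S A B : C} {f : S ⟶ A} {g : S ⟶ B}

lemma exists_of_eq (hS : IsMalcevSpan f g) {W : C} (x₁ x₂ x₃ : W ⟶ S) (hg : x₁ ≫ g = x₂ ≫ g)
    (hf : x₂ ≫ f = x₃ ≫ f) : ∃ y : W ⟶ S, y ≫ f = x₁ ≫ f ∧ y ≫ g = x₃ ≫ g := by
  obtain ⟨m, hm₁, hm₂⟩ := hS.exists_factorization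
  refine ⟨pullback.lift (pullback.lift x₁ x₂ hg) x₃ (by simpa) ≫ m, ?_, ?_⟩
  · simp [hm₁]
  · simp [hm₂]

lemma linked_symm (hS : IsMalcevSpan f g) {W : C} {s s' : W ⟶ S} (h : Linked f g s s') :
    Linked f g s' s := by
  obtain ⟨t, h₁, h₂⟩ := h
  exact hS.exists_of_eq s' t s h₂.symm h₁

lemma linked_trans (hS : IsMalcevSpan f g) {W : C} {s s' s'' : W ⟶ S} (h : Linked f g s s')
    (h' : Linked f g s' s'') : Linked f g s s'' := by
  obtain ⟨t, h₁, h₂⟩ := h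
  obtain ⟨t', h₁', h₂'⟩ := h'
  obtain ⟨y, hy₁, hy₂⟩ := hS.exists_of_eq t s' t' h₂ h₁'.symm
  exact ⟨y, hy₁.trans h₁, hy₂.trans h₂'⟩

lemma mono_prodLift (hS : IsMalcevSpan f g) : Mono (prod.lift f g) where
  right_cancellation a b h := by
    refine hS.jointlyMono.right_cancellation a b ?_ ?_
    · simpa using congr($h ≫ prod.fst)
    · simpa using congr($h ≫ prod.snd)

end Malcev

/-! ### Quotients by the gluing relation -/

section Pretopos

variable [Pretopos C] {S A B : C} {f : S ⟶ A} {g : S ⟶ B}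

/-- An element of A and one of B can only be glued through linked elements, whose witness is the
required element of S; local lifts assemble because S embeds in A ⨯ B. -/
lemma IsGluing.isPullback (hS : IsMalcevSpan f g) {D : C} {h : A ⟶ D} {k : B ⟶ D}
    (H : IsGluing f g h k) : IsPullback f g h k := by
  have key : ∀ {W : C} (a : W ⟶ A) (b : W ⟶ B), a ≫ h = b ≫ k →
      ∃ l : W ⟶ S, l ≫ prod.lift f g = prod.lift a b := by
    intro W a b hab
    have := hS.mono_prodLift
    refine H.glued (a ≫ coprod.inl) (b ≫ coprod.inr) (by simpa) _ _ ?_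
    rintro W' i (hi | ⟨s, s', ⟨t, ht₁, ht₂⟩, hx, hy⟩)
    · simp only [← Category.assoc] at hi
      obtain ⟨hW⟩ := nonempty_isInitial_of_inl_eq_inr hi
      exact ⟨hW.to _, hW.hom_ext _ _⟩
    · rcases hx with hx | hx
      · rcases hy with hy | hy
        · simp only [← Category.assoc] at hy
          obtain ⟨hW⟩ := nonempty_isInitial_of_inl_eq_inr hy.symm
          exact ⟨hW.to _, hW.hom_ext _ _⟩
        · have hx' : i ≫ a = s ≫ f := by simpa [← Category.assoc, cancel_mono] using hx
          have hy' : i ≫ b = s' ≫ g := by simpa [← Category.assoc, cancel_mono] using hy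
          refine ⟨t, ?_⟩
          ext <;> simp [hx', hy', ht₁, ht₂]
      · simp only [← Category.assoc] at hx
        obtain ⟨hW⟩ := nonempty_isInitial_of_inl_eq_inr hx
        exact ⟨hW.to _, hW.hom_ext _ _⟩
  refine ⟨⟨H.w⟩, ⟨PullbackCone.IsLimit.mk _ (fun c => (key c.fst c.snd c.condition).choose)
    ?_ ?_ ?_⟩⟩
  · intro c
    simpa using congr($((key c.fst c.snd c.condition).choose_spec) ≫ prod.fst)
  · intro c
    simpa using congr($((key c.fst c.snd c.condition).choose_spec) ≫ prod.snd)
  · intro c m h₁ h₂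
    have := hS.mono_prodLift
    rw [← cancel_mono (prod.lift f g), (key c.fst c.snd c.condition).choose_spec]
    ext <;> simp [h₁, h₂]

lemma IsGluing.isPushout_of_cube {D : C} {h : A ⟶ D} {k : B ⟶ D}
    (H : IsGluing f g h k) {S' A' B' D' : C} (f' : S' ⟶ A') (g' : S' ⟶ B') (h' : A' ⟶ D')
    (k' : B' ⟶ D') (c : S' ⟶ S) (a : A' ⟶ A) (b : B' ⟶ B) (d : D' ⟶ D)
    (w : f' ≫ h' = g' ≫ k') (hf : IsPullback f' c a f) (hg : IsPullback g' c b g)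
    (hh : IsPullback h' a d h) (hk : IsPullback k' b d k) : IsPushout f' g' h' k' := by
  have hd : coprod.desc h' k' ≫ d = coprod.map a b ≫ coprod.desc h k := by
    ext
    · simp [hh.w]
    · simp [hk.w]
  have hreg : IsRegularEpi (coprod.desc h' k') := by
    -- Locally, an element of D' has image in D coming from A or from B, so it lifts to A' or B' by
    -- the pullback faces.
    refine isRegularEpi_of_factors _ fun Z u i _ hu => ?_
    have := H.isRegularEpi
    refine isJointlyExtremal_of_isRegularEpi (coprod.desc h k) d i (𝟙 D') ?_
    rintro W j ⟨x, hx⟩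
    refine isJointlyExtremal_of_coprod x i _ ?_
    rintro W' j' (⟨y, hy⟩ | ⟨y, hy⟩)
    · refine ⟨hh.lift (j' ≫ j) y (by simp [hx, reassoc_of% hy]) ≫ coprod.inl ≫ u, ?_⟩
      simp [hu]
    · refine ⟨hk.lift (j' ≫ j) y (by simp [hx, reassoc_of% hy]) ≫ coprod.inr ≫ u, ?_⟩
      simp [hu]
  -- `A' ⨿ B'` embeds into the pullback of `A ⨿ B` along `d`
  have hext : ∀ {W : C} (x y : W ⟶ A' ⨿ B'), x ≫ coprod.map a b = y ≫ coprod.map a b →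
      x ≫ coprod.desc h' k' = y ≫ coprod.desc h' k' → x = y := by
    intro W x y h₁ h₂
    -- Decompose both x and y by summands; disjointness makes the mixed cases vacuous.
    refine ((isJointlyExtremal_of_coprod x).bind (R := fun W' i => i ≫ x = i ≫ y)
      (fun W' i _ => isJointlyExtremal_of_coprod (i ≫ y)) ?_).hom_ext fun _ _ => id
    rintro W' i hx W'' j hy
    have h₁' := congr(j ≫ i ≫ $h₁)
    have h₂' := congr(j ≫ i ≫ $h₂)
    rcases hx with ⟨p, hp⟩ | ⟨p, hp⟩ <;> rcases hy with ⟨q, hq⟩ | ⟨q, hq⟩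
    all_goals
      rw [Category.assoc, Category.assoc, hq, hp]
      rw [reassoc_of% hp, reassoc_of% hq] at h₁' h₂'
    · simp only [coprod.inl_map, coprod.inl_desc] at h₁' h₂'
      rw [← Category.assoc]
      congr 1
      refine hh.hom_ext (by simpa using h₂') ?_
      simpa [← Category.assoc, cancel_mono] using h₁'
    · simp only [coprod.inl_map, coprod.inr_map, ← Category.assoc] at h₁'
      obtain ⟨hW⟩ := nonempty_isInitial_of_inl_eq_inr h₁'
      exact hW.hom_ext _ _
    · simp only [coprod.inl_map, coprod.inr_map, ← Category.assoc] at h₁'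
      obtain ⟨hW⟩ := nonempty_isInitial_of_inl_eq_inr h₁'.symm
      exact hW.hom_ext _ _
    · simp only [coprod.inr_map, coprod.inr_desc] at h₁' h₂'
      rw [← Category.assoc]
      congr 1
      refine hk.hom_ext (by simpa using h₂') ?_
      simpa [← Category.assoc, cancel_mono] using h₁'
  have hlift : ∀ {W : C} (s : W ⟶ S) (x : W ⟶ A' ⨿ B'), Over f g s (x ≫ coprod.map a b) →
      ∃ s' : W ⟶ S', s' ≫ c = s ∧ Over f' g' s' x := by
    intro W s x hx
    have e : x ≫ coprod.desc h' k' ≫ d = s ≫ f ≫ h := by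
      rw [hd, ← Category.assoc, hx.comp_desc H.w]
    rcases hx with hx | hx
    · let a₁ : W ⟶ A' := hh.lift (x ≫ coprod.desc h' k') (s ≫ f) (by simpa using e)
      refine ⟨hf.lift a₁ s (by simp [a₁]), by simp, .inl (hext _ _ ?_ ?_)⟩
      · simp [hx, a₁]
      · simp [a₁]
    · let b₁ : W ⟶ B' := hk.lift (x ≫ coprod.desc h' k') (s ≫ g) (by simpa [H.w] using e)
      refine ⟨hg.lift b₁ s (by simp [b₁]), by simp, .inr (hext _ _ ?_ ?_)⟩
      · simp [hx, b₁]
      · simp [b₁]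
  have hdesc : ∀ {T : C} (u : A' ⟶ T) (u' : B' ⟶ T), f' ≫ u = g' ≫ u' →
      ∃ v : D' ⟶ T, coprod.desc h' k' ≫ v = coprod.desc u u' := by
    intro T u u' hu
    -- A regular epimorphism is the coequaliser of its kernel pair, so it remains to see, locally,
    -- that x and y are identified.
    refine IsRegularEpi.exists_of_isKernelPair _ (IsKernelPair.of_hasPullback _) _ ?_
    generalize hx : pullback.fst (coprod.desc h' k') (coprod.desc h' k') = x
    generalize hy : pullback.snd (coprod.desc h' k') (coprod.desc h' k') = y
    have hxy : x ≫ coprod.desc h' k' = y ≫ coprod.desc h' k' := by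
      rw [← hx, ← hy, pullback.condition]
    refine (H.glued (x ≫ coprod.map a b) (y ≫ coprod.map a b) (by
      simp only [Category.assoc, ← hd, reassoc_of% hxy])).hom_ext ?_
    rintro W i (hi | ⟨s, s', ⟨t, ht₁, ht₂⟩, hs, hs'⟩)
    · rw [← Category.assoc, ← Category.assoc, hext (i ≫ x) (i ≫ y) (by simpa using hi)
        (by simp [hxy])]
    · obtain ⟨r, hr, hrx⟩ := hlift s (i ≫ x) (by simpa using hs)
      obtain ⟨r', hr', hry⟩ := hlift s' (i ≫ y) (by simpa using hs')
      have e : r ≫ f' ≫ h' = r' ≫ f' ≫ h' := by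
        rw [← hrx.comp_desc w, ← hry.comp_desc w]
        simp [hxy]
      -- The link t lifts to a link t' between r and r', so that u f' r = u f' t' = u' g' t' = u' g'
      -- r'.
      let t' : W ⟶ S' := hf.lift (r ≫ f') t (by rw [ht₁, Category.assoc, hf.w, reassoc_of% hr])
      have ht' : t' ≫ g' = r' ≫ g' := by
        refine hk.hom_ext ?_ ?_
        · rw [Category.assoc, Category.assoc, ← w, ← e]
          simp [t']
        · rw [Category.assoc, Category.assoc, hg.w, reassoc_of% hr', ← ht₂]
          simp [t']
      rw [← Category.assoc, ← Category.assoc, hrx.comp_desc hu, hry.comp_desc hu, hu,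
        ← reassoc_of% ht', ← hu]
      simp [t']
  refine ⟨⟨w⟩, ⟨PushoutCocone.IsColimit.mk _
    (fun s => (hdesc s.inl s.inr s.condition).choose) ?_ ?_ ?_⟩⟩
  · intro s
    simpa using congr(coprod.inl ≫ $((hdesc s.inl s.inr s.condition).choose_spec))
  · intro s
    simpa using congr(coprod.inr ≫ $((hdesc s.inl s.inr s.condition).choose_spec))
  · intro s m h₁ h₂
    rw [← cancel_epi (coprod.desc h' k'), (hdesc s.inl s.inr s.condition).choose_spec]
    ext <;> simp [h₁, h₂]

lemma IsGluing.isPushout {D : C} {h : A ⟶ D} {k : B ⟶ D} (H : IsGluing f g h k) :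
    IsPushout f g h k :=
  H.isPushout_of_cube f g h k (𝟙 _) (𝟙 _) (𝟙 _) (𝟙 _) H.w (.of_vert_isIso ⟨by simp⟩)
    (.of_vert_isIso ⟨by simp⟩) (.of_vert_isIso ⟨by simp⟩) (.of_vert_isIso ⟨by simp⟩)

/-- The relation `Glued f g` is represented by a subobject of `(A ⨿ B) ⨯ (A ⨿ B)`. -/
lemma exists_mono_representing_glued (f : S ⟶ A) (g : S ⟶ B) :
    ∃ (E : C) (e : E ⟶ (A ⨿ B) ⨯ (A ⨿ B)), Mono e ∧
      (∃ r, r ≫ e = diag (A ⨿ B)) ∧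
      (∀ ⦃W : C⦄ (s s' : W ⟶ S) (x y : W ⟶ A ⨿ B), Linked f g s s' → Over f g s x →
        Over f g s' y → ∃ l, l ≫ e = prod.lift x y) ∧
      ∀ ⦃W : C⦄ (l : W ⟶ E), Glued f g (l ≫ e ≫ prod.fst) (l ≫ e ≫ prod.snd) := by
  -- `N` classifies pairs of elements of `S ⨿ S` lying over linked elements of `S`
  let δ : S ⨿ S ⟶ S := coprod.desc (𝟙 S) (𝟙 S)
  let p : S ⨿ S ⟶ A ⨿ B := coprod.map f g
  let ψ : (S ⨿ S) ⨯ (S ⨿ S) ⟶ A ⨯ B := prod.map (δ ≫ f) (δ ≫ g)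
  let z₁ : pullback (prod.lift f g) ψ ⟶ S ⨿ S := pullback.snd _ _ ≫ prod.fst
  let z₂ : pullback (prod.lift f g) ψ ⟶ S ⨿ S := pullback.snd _ _ ≫ prod.snd
  -- The subobject is the image of the diagonal together with the pairs from N.
  let F := Regular.strongEpiMonoFactorisation
    (coprod.desc (diag (A ⨿ B)) (prod.lift (z₁ ≫ p) (z₂ ≫ p)))
  have hover : ∀ ⦃W : C⦄ (z : W ⟶ S ⨿ S),
      ((∃ a, z = a ≫ coprod.inl) ∨ ∃ b, z = b ≫ coprod.inr) → Over f g (z ≫ δ) (z ≫ p) := by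
    rintro W z (⟨a, rfl⟩ | ⟨b, rfl⟩)
    · exact .inl (by simp [δ, p])
    · exact .inr (by simp [δ, p])
  have hlift : ∀ ⦃W : C⦄ (s : W ⟶ S) (x : W ⟶ A ⨿ B), Over f g s x →
      ∃ z : W ⟶ S ⨿ S, z ≫ δ = s ∧ z ≫ p = x := by
    rintro W s x (rfl | rfl)
    · exact ⟨s ≫ coprod.inl, by simp [δ], by simp [p]⟩
    · exact ⟨s ≫ coprod.inr, by simp [δ], by simp [p]⟩
  refine ⟨F.I, F.m, inferInstance, ⟨coprod.inl ≫ F.e, by simp⟩, ?_, ?_⟩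
  · rintro W s s' x y ⟨t, ht₁, ht₂⟩ hx hy
    obtain ⟨z, rfl, rfl⟩ := hlift s x hx
    obtain ⟨z', rfl, rfl⟩ := hlift s' y hy
    refine ⟨pullback.lift t (prod.lift z z') ?_ ≫ coprod.inr ≫ F.e, ?_⟩
    · ext <;> simp [ψ, ht₁, ht₂]
    · simp only [Category.assoc, F.fac, coprod.inr_desc]
      ext <;> simp [z₁, z₂]
  · intro W l
    refine (isJointlyExtremal_of_isRegularEpi F.e l).bind
      (Q := fun W' i W'' j => ∃ v : W' ⟶ _, i ≫ l = v ≫ F.e ∧ ((∃ a, j ≫ v = a ≫ coprod.inl) ∨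
        ∃ n, j ≫ v = n ≫ coprod.inr ∧
          ((∃ a, n ≫ z₁ = a ≫ coprod.inl) ∨ ∃ b, n ≫ z₁ = b ≫ coprod.inr) ∧
          ((∃ a, n ≫ z₂ = a ≫ coprod.inl) ∨ ∃ b, n ≫ z₂ = b ≫ coprod.inr))) ?_ ?_
    -- Split v into diagonal part and N part, then on the latter split both components by the
    -- summands of S ⨿ S.
    · rintro W' i ⟨v, hv⟩
      intro E' Y e' _ y hy
      refine isJointlyExtremal_of_coprod v e' y ?_
      rintro W₁ j₁ (⟨a, ha⟩ | ⟨n, hn⟩)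
      · exact hy _ ⟨v, hv, .inl ⟨a, ha⟩⟩
      refine isJointlyExtremal_of_coprod (n ≫ z₁) e' _ ?_
      intro W₂ j₂ h₂
      refine isJointlyExtremal_of_coprod ((j₂ ≫ n) ≫ z₂) e' _ ?_
      intro W₃ j₃ h₃
      have h₂' : (∃ a, (j₃ ≫ j₂ ≫ n) ≫ z₁ = a ≫ coprod.inl) ∨
          ∃ b, (j₃ ≫ j₂ ≫ n) ≫ z₁ = b ≫ coprod.inr := by
        rcases h₂ with ⟨a, ha⟩ | ⟨a, ha⟩
        · exact .inl ⟨j₃ ≫ a, by simp [ha]⟩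
        · exact .inr ⟨j₃ ≫ a, by simp [ha]⟩
      obtain ⟨l, hl⟩ := hy (j₃ ≫ j₂ ≫ j₁)
        ⟨v, hv, .inr ⟨j₃ ≫ j₂ ≫ n, by simp [hn], h₂', by simpa using h₃⟩⟩
      exact ⟨l, by simpa using hl⟩
    · rintro W' i - W'' j ⟨v, hv, ⟨a, ha⟩ | ⟨n, hn, h₁, h₂⟩⟩
      · left
        have e : j ≫ i ≫ l ≫ F.m = a ≫ diag (A ⨿ B) := by
          rw [reassoc_of% hv, F.fac, reassoc_of% ha, coprod.inl_desc]
        simp [reassoc_of% e]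
      · right
        have e : j ≫ i ≫ l ≫ F.m = n ≫ prod.lift (z₁ ≫ p) (z₂ ≫ p) := by
          rw [reassoc_of% hv, F.fac, reassoc_of% hn, coprod.inr_desc]
        have hψ := pullback.condition (f := prod.lift f g) (g := ψ)
        refine ⟨(n ≫ z₁) ≫ δ, (n ≫ z₂) ≫ δ, ⟨n ≫ pullback.fst _ _, ?_, ?_⟩, ?_, ?_⟩
        · simpa [ψ, z₁] using congr(n ≫ $hψ ≫ prod.fst)
        · simpa [ψ, z₂] using congr(n ≫ $hψ ≫ prod.snd)
        · convert hover _ h₁ using 1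
          simp [reassoc_of% e]
        · convert hover _ h₂ using 1
          simp [reassoc_of% e]

lemma exists_isGluing (hS : IsMalcevSpan f g) :
    ∃ (D : C) (h : A ⟶ D) (k : B ⟶ D), IsGluing f g h k := by
  obtain ⟨E, e, _, ⟨r, hr⟩, hrel, hE⟩ := exists_mono_representing_glued f g
  have heq : IsEquivalenceRelation (e ≫ prod.fst) (e ≫ prod.snd) := by
    refine .of_generalizedElements ⟨fun W a b h₁ h₂ => ?_⟩ ⟨r, ?_, ?_⟩ ?_ ?_
    · rw [← cancel_mono e]
      ext
      · simpa using h₁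
      · simpa using h₂
    · simp [reassoc_of% hr]
    · simp [reassoc_of% hr]
    · obtain ⟨σ, hσ⟩ := hE (𝟙 E) e (prod.lift (e ≫ prod.snd) (e ≫ prod.fst)) (by
        rintro W i (hi | ⟨s, s', hl, hx, hy⟩)
        · simp only [Category.id_comp] at hi
          refine ⟨i, ?_⟩
          ext <;> simp [hi]
        · simp only [Category.id_comp] at hx hy
          obtain ⟨l, hl⟩ := hrel s' s _ _ (hS.linked_symm hl) hy hx
          exact ⟨l, by rw [hl]; ext <;> simp⟩)
      exact ⟨σ, by simp [reassoc_of% hσ], by simp [reassoc_of% hσ]⟩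
    · intro W a b hab
      obtain ⟨c, hc⟩ : ∃ c, c ≫ e = prod.lift (a ≫ e ≫ prod.fst) (b ≫ e ≫ prod.snd) := by
        -- Membership in the mono `e` is tested on a cover for a, refined by one for b. There the
        -- middle element is the image of both s₁' and s₂, so these are linked and the chain
        -- composes.
        refine hE a e _ ?_
        rintro W₁ i (hi | ⟨s₁, s₁', hl₁, hx₁, hy₁⟩)
        · refine ⟨i ≫ b, ?_⟩
          ext <;> simp [hi, hab]
        refine hE (i ≫ b) e _ ?_
        rintro W₂ j (hj | ⟨s₂, s₂', hl₂, hx₂, hy₂⟩)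
        · refine ⟨j ≫ i ≫ a, ?_⟩
          simp only [Category.assoc] at hj
          ext <;> simp [← hj, hab]
        · rw [hab] at hy₁
          have hm := (hy₁.comp j).linked (by simpa using hx₂)
          obtain ⟨l, hl⟩ := hrel (j ≫ s₁) s₂' _ _
            (hS.linked_trans (hl₁.comp j) (hS.linked_trans hm hl₂)) (hx₁.comp j) hy₂
          exact ⟨l, by rw [hl]; ext <;> simp⟩
      exact ⟨c, by simp [reassoc_of% hc], by simp [reassoc_of% hc]⟩
  obtain ⟨D, q, hq, hker⟩ := BarrExact.exists_isRegularEpi_isKernelPair _ _ heq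
  have hdesc : coprod.desc (coprod.inl ≫ q) (coprod.inr ≫ q) = q := by ext <;> simp
  refine ⟨D, coprod.inl ≫ q, coprod.inr ≫ q, ⟨?_, by rwa [hdesc], fun W x y hxy => ?_⟩⟩
  · obtain ⟨l, hl⟩ := hrel (𝟙 S) (𝟙 S) (f ≫ coprod.inl) (g ≫ coprod.inr) ⟨𝟙 S, rfl, rfl⟩
      (.inl (by simp)) (.inr (by simp))
    simpa [reassoc_of% hl] using congr(l ≫ $(hker.w))
  · rw [hdesc] at hxy
    simpa using hE (hker.lift x y hxy)

/-- Pushouts are unique up to isomorphism, so every pushout inherits the properties of the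
constructed quotient. -/
lemma isGluing_of_isPushout (hS : IsMalcevSpan f g) {D : C} {h : A ⟶ D} {k : B ⟶ D}
    (H : IsPushout f g h k) : IsGluing f g h k := by
  obtain ⟨D', h', k', H'⟩ := hS.exists_isGluing
  simpa using H'.comp_iso (H'.isPushout.isoIsPushout _ _ H)

end Pretopos

end IsMalcevSpan

theorem proposition1 (C : Type u) [Category.{v} C] [Pretopos C] : Diexact C := by
  refine { hasPushout := fun f g hS => ?_, isStablePushout := fun f g h k hS H => ?_,
           isPullback := fun f g h k hS H => (hS.isGluing_of_isPushout H).isPullback hS }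
  · obtain ⟨D, h, k, H⟩ := hS.exists_isGluing
    exact H.isPushout.hasPushout
  · exact ⟨H, (hS.isGluing_of_isPushout H).isPushout_of_cube⟩
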